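/- Let $X$ be a smooth closed connected oriented $4$-manifold with a $(g;k_1,k_2,k_3)$-trisection $X=V_1\cup V_2\cup V_3$, that is, $V_i\cong\natural^{k_i}(S^1\times B^3)$, the intersections $W_\alpha=V_1\cap V_2$, $W_\beta=V_1\cap V_3$, $W_\gamma=V_2\cap V_3$ are $3$-dimensional handlebodies of genus $g$ with common boundary the closed oriented surface $\Sigma=V_1\cap V_2\cap V_3$, and $\partial V_1=W_\alpha\cup W_\beta$, $\partial V_2=W_\alpha\cup W_\gamma$, $\partial V_3=W_\beta\cup W_\gamma$. Let $(\Sigma;\alpha,\beta,\gamma)$ be a diagram of the trisection: for $\epsilon\in\{\alpha,\beta,\gamma\}$, $\epsilon_1,\dots,\epsilon_g$ are oriented defining curves for $W_\epsilon$, i.e. disjoint simple closed curves in $\Sigma$ with connected complement that bound disjoint properly embedded discs in $W_\epsilon$. Let $\langle\cdot,\cdot\rangle_\Sigma$ be the intersection form on $H_1(\Sigma;\mathbb Z)$, let $L_\epsilon\subset H_1(\Sigma;\mathbb Z)$ be the subgroup generated by $[\epsilon_1],\dots,[\epsilon_g]$, and let ${}_\epsilon Q_\delta$ be the integer matrix $(\langle[\epsilon_i],[\delta_j]\rangle_\Sigma)_{i,j}$.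 Let $I_g^m$ be the $g\times g$ matrix with the $m\times m$ identity matrix in its upper left corner and zeros elsewhere. Let $\Phi$ be the bilinear form on $L_\gamma\cap(L_\alpha+L_\beta)$ given by $\Phi(x,y)=\langle x',y\rangle_\Sigma$, where $x'\in L_\alpha$ is any element with $x-x'\in L_\beta$. An element $x\in L_\gamma\cap(L_\alpha+L_\beta)$ represents the following class in $H_2(X;\mathbb Z)$: a $1$-cycle $c$ of class $x$ in $\Sigma$, written as a sum of $1$-cycles $c=a+b$ of $\Sigma$, where $c$, $a$, $b$ bound $2$-chains $u_\gamma$, $u_\alpha$, $u_\beta$ in $W_\gamma$, $W_\alpha$, $W_\beta$, gives the class $[u_\gamma-(u_\alpha+u_\beta)]$. Suppose that ${}_\alpha Q_\beta=I_g^{g-k_1}$. Let $A$ be an integer matrix with $g$ rows whose columns are the coordinate vectors, with respect to $[\gamma_1],\dots,[\gamma_g]$, of elements $x_1,\dots,x_n$ of $L_\gamma\cap(L_\alpha+L_\beta)$ that represent a basis of $H_2(X;\mathbb Z)/\mathrm{torsion}$. Then with respect to this basis $\Phi$ is represented by the matrix $$A^{T}\;{}_\gamma Q_\beta\; I_g^{g-k_1}\;{}_\alpha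 Q_\gamma\; A ,$$ that is, $\Phi(x_i,x_j)$ is the $(i,j)$ entry of this matrix for all $i,j$; consequently every bilinear form on $H_2(X;\mathbb Z)/\mathrm{torsion}$ induced by $\Phi$ (with value $\Phi(x,y)$ on the classes represented by $x,y$, for all $x,y\in L_\gamma\cap(L_\alpha+L_\beta)$) has this matrix in this basis. -/

import Mathlib

open CategoryTheory Set
open scoped Manifold ContDiff Simplicial

noncomputable section

/-! ## Singular chains and homology with integer coefficients -/

/-- The singular chain complex of `Y` with integer coefficients. -/
abbrev singChains (Y : Type) [TopologicalSpace Y] : ChainComplex (ModuleCat.{0} ℤ) ℕ :=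
  ((AlgebraicTopology.singularChainComplexFunctor (ModuleCat.{0} ℤ)).obj
    (ModuleCat.of ℤ ℤ)).obj (TopCat.of Y)

/-- The singular homology group `H_n(Y; ℤ)`. -/
abbrev singHomology (n : ℕ) (Y : Type) [TopologicalSpace Y] : ModuleCat.{0} ℤ :=
  ((AlgebraicTopology.singularHomologyFunctor (ModuleCat.{0} ℤ) n).obj
    (ModuleCat.of ℤ ℤ)).obj (TopCat.of Y)

/-- The map on singular `n`-chains induced by a continuous map. -/
def chainPush {Y Z : Type} [TopologicalSpace Y] [TopologicalSpace Z] (f : C(Y, Z)) (n : ℕ) :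
    (singChains Y).X n →ₗ[ℤ] (singChains Z).X n :=
  ((((AlgebraicTopology.singularChainComplexFunctor (ModuleCat.{0} ℤ)).obj
    (ModuleCat.of ℤ ℤ)).map (TopCat.ofHom f)).f n).hom

/-- The boundary map from `(n+1)`-chains to `n`-chains. -/
def chainBoundary (Y : Type) [TopologicalSpace Y] (n : ℕ) :
    (singChains Y).X (n + 1) →ₗ[ℤ] (singChains Y).X n :=
  ((singChains Y).d (n + 1) n).hom

/-- The `n`-chain `c` is a cycle, and its homology class is `x`. -/
def IsCycleOfClass {Y : Type} [TopologicalSpace Y] {n : ℕ} (c : (singChains Y).X n)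
    (x : singHomology n Y) : Prop :=
  ∃ ζ : (singChains Y).cycles n,
    ((singChains Y).iCycles n).hom ζ = c ∧ ((singChains Y).homologyπ n).hom ζ = x

/-! ## Oriented smooth surfaces, smooth loops, and the intersection form -/

/-- The charts of the (smooth) atlas of `M` have orientation preserving transition maps; such an
atlas orients `M`. -/
def IsOrientedAtlas (n : ℕ) (M : Type) [TopologicalSpace M]
    [ChartedSpace (EuclideanSpace ℝ (Fin n)) M] : Prop :=
  ∀ e ∈ atlas (EuclideanSpace ℝ (Fin n)) M, ∀ e' ∈ atlas (EuclideanSpace ℝ (Fin n)) M,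
    ∀ x ∈ (e.symm ≫ₕ e').source, 0 < (fderiv ℝ (e.symm ≫ₕ e') x).det

/-- An oriented smooth loop on the surface `S`: a smooth map `ℝ → S` of period `1`. -/
structure SmoothLoop (S : Type) [TopologicalSpace S]
    [ChartedSpace (EuclideanSpace ℝ (Fin 2)) S] where
  toFun : ℝ → S
  smooth : ContMDiff 𝓘(ℝ, ℝ) (𝓡 2) ∞ toFun
  periodic : ∀ t, toFun (t + 1) = toFun t

namespace SmoothLoop

variable {S : Type} [TopologicalSpace S] [ChartedSpace (EuclideanSpace ℝ (Fin 2)) S]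

/-- The velocity of a loop at time `t`, in the coordinates given by the preferred chart at the
point `c t` (which belongs to the atlas). -/
def velocity (c : SmoothLoop S) (t : ℝ) : EuclideanSpace ℝ (Fin 2) :=
  mfderiv 𝓘(ℝ, ℝ) (𝓡 2) c.toFun t (1 : ℝ)

/-- The loop is an embedded closed curve: an immersion, injective on a period. -/
def IsSimple (c : SmoothLoop S) : Prop :=
  (∀ t, c.velocity t ≠ 0) ∧ InjOn c.toFun (Ico 0 1)

/-- The determinant of the pair of velocities `(a'(s), b'(t))`; it is used where
`a(s) = b(t)`, so that both velocities are written in the same chart. -/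
def crossing (a b : SmoothLoop S) (s t : ℝ) : ℝ :=
  a.velocity s 0 * b.velocity t 1 - a.velocity s 1 * b.velocity t 0

/-- The pairs of parameters in a period at which the two loops meet. -/
def meets (a b : SmoothLoop S) : Set (ℝ × ℝ) :=
  {p | p.1 ∈ Ico (0 : ℝ) 1 ∧ p.2 ∈ Ico (0 : ℝ) 1 ∧ a.toFun p.1 = b.toFun p.2}

/-- The loops are transverse. -/
def Transverse (a b : SmoothLoop S) : Prop :=
  ∀ p ∈ meets a b, crossing a b p.1 p.2 ≠ 0

/-- The algebraic number of intersections: the sum of the signs of the crossings, where a crossing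
is positive if `(a', b')` is a positively oriented frame. (The sum is finite when `S` is Hausdorff
and the loops are transverse.) -/
def signedCount (a b : SmoothLoop S) : ℤ :=
  ∑ᶠ p ∈ meets a b, ((SignType.sign (crossing a b p.1 p.2) : SignType) : ℤ)

/-- The singular `1`-simplex that runs once along the loop. -/
def simplex (c : SmoothLoop S) : (TopCat.toSSet.obj (TopCat.of S)) _⦋1⦌ :=
  (TopCat.toSSetObjEquiv (TopCat.of S) (.op ⦋1⦌)).symm
    ⟨fun x => c.toFun (x.1 1),
      c.smooth.continuous.comp ((continuous_apply 1).comp continuous_subtype_val)⟩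

theorem face_simplex (c : SmoothLoop S) :
    (TopCat.toSSet.obj (TopCat.of S)).δ 0 c.simplex
      = (TopCat.toSSet.obj (TopCat.of S)).δ 1 c.simplex := by
  apply (TopCat.toSSetObjEquiv (TopCat.of S) (.op ⦋0⦌)).injective
  ext x
  have h : ∀ i : Fin 2, (TopCat.toSSetObjEquiv (TopCat.of S) (.op ⦋0⦌)
      ((TopCat.toSSet.obj (TopCat.of S)).δ i c.simplex)) x
      = c.toFun ((stdSimplex.map (S := ℝ) (SimplexCategory.δ i).toOrderHom x).1 1) :=
    fun i => rfl
  have hx : ∀ i : Fin 2, (stdSimplex.map (S := ℝ) (SimplexCategory.δ i).toOrderHom x)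
      = stdSimplex.vertex (i.succAbove 0) := by
    intro i
    have : x = stdSimplex.vertex 0 := Subsingleton.elim (α := stdSimplex ℝ (Fin 1)) _ _
    rw [this]
    exact stdSimplex.map_vertex _ _
  rw [h, h, hx, hx]
  have := c.periodic 0
  simpa using this

theorem simplex_boundary (c : SmoothLoop S) :
    (TopCat.toSSet.obj (TopCat.of S)).ιChainComplex (R := ModuleCat.of ℤ ℤ) c.simplex
      ≫ (singChains S).d 1 0 = 0 := by
  refine ((TopCat.toSSet.obj (TopCat.of S)).ιChainComplex_d (R := ModuleCat.of ℤ ℤ)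
    c.simplex).trans ?_
  simp [Fin.sum_univ_two, face_simplex]
  rfl

/-- The class in `H_1(S; ℤ)` of the cycle consisting of the singular simplex `c.simplex`. -/
def homologyClass (c : SmoothLoop S) : singHomology 1 S :=
  ((singChains S).liftCycles
    ((TopCat.toSSet.obj (TopCat.of S)).ιChainComplex (R := ModuleCat.of ℤ ℤ) c.simplex) 0
    (ChainComplex.next_nat_succ 0) c.simplex_boundary ≫ (singChains S).homologyπ 1).hom (1 : ℤ)

end SmoothLoop

/-- `F` is the intersection form of the oriented surface `S`: the alternating bilinear form on
`H_1(S; ℤ)` whose value on the classes of two transverse oriented smooth loops is their algebraic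
number of intersections. (On a closed oriented surface there is exactly one such form.) -/
def IsIntersectionForm {S : Type} [TopologicalSpace S]
    [ChartedSpace (EuclideanSpace ℝ (Fin 2)) S]
    (F : LinearMap.BilinForm ℤ (singHomology 1 S)) : Prop :=
  F.IsAlt ∧ ∀ a b : SmoothLoop S, a.Transverse b →
    F a.homologyClass b.homologyClass = a.signedCount b

open Classical in
/-- The intersection form `⟨·,·⟩_S` on `H_1(S; ℤ)` of a closed oriented surface `S`. -/
def intersectionForm (S : Type) [TopologicalSpace S]
    [ChartedSpace (EuclideanSpace ℝ (Fin 2)) S] :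
    LinearMap.BilinForm ℤ (singHomology 1 S) :=
  if h : ∃ F : LinearMap.BilinForm ℤ (singHomology 1 S), IsIntersectionForm F
  then h.choose else 0

/-! ## Trisections and their diagrams -/

/-- The disc with `m` holes: the disc of radius `4m+4` about `0`, minus the open unit discs about
`4, 8, …, 4m`. -/
def holedDisc (m : ℕ) : Set ℂ :=
  {z | ‖z‖ ≤ 4 * m + 4 ∧ ∀ i : Fin m, 1 ≤ ‖z - 4 * ((i : ℕ) + 1)‖}

/-- The 3-dimensional handlebody of genus `m`. -/
def handlebody3 (m : ℕ) : Set (ℂ × ℝ) := holedDisc m ×ˢ Icc 0 1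

/-- The 4-dimensional handlebody `♮^m (S¹ × B³)`. -/
def handlebody4 (m : ℕ) : Set (ℂ × ℝ × ℝ) := holedDisc m ×ˢ (Icc 0 1 ×ˢ Icc 0 1)

/-- `W` is homeomorphic to the model `M` (a compact codimension-0 submanifold of `E`), and `B ⊆ W`
corresponds to the boundary of `M`. -/
def IsModelled {X E : Type} [TopologicalSpace X] [TopologicalSpace E] (M : Set E)
    (W B : Set X) : Prop :=
  B ⊆ W ∧ ∃ h : W ≃ₜ M, ∀ w : W, (w : X) ∈ B ↔ (h w : E) ∈ frontier M

/-- The oriented curves `c₁, …, c_g` on the surface `S` (embedded in `X` by `e`) are defining curves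
for the handlebody `W` with boundary `e(S)`: they are disjoint embedded closed curves whose union
does not separate `S`, and they bound disjoint discs properly embedded in `W`. -/
def IsDefiningCurves {S X : Type} [TopologicalSpace S] [TopologicalSpace X]
    [ChartedSpace (EuclideanSpace ℝ (Fin 2)) S] {g : ℕ} (e : S → X) (W : Set X)
    (c : Fin g → SmoothLoop S) : Prop :=
  (∀ i, (c i).IsSimple) ∧
  (∀ i j, i ≠ j → Disjoint (range (c i).toFun) (range (c j).toFun)) ∧
  IsConnected (⋃ i, range (c i).toFun)ᶜ ∧
  ∃ D : Fin g → Metric.closedBall (0 : ℂ) 1 → X,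
    (∀ i, Continuous (D i) ∧ Function.Injective (D i) ∧ range (D i) ⊆ W) ∧
    (∀ i, D i '' {z | ‖(z : ℂ)‖ = 1} = e '' range (c i).toFun) ∧
    (∀ i z, D i z ∈ range e → ‖(z : ℂ)‖ = 1) ∧
    (∀ i j, i ≠ j → Disjoint (range (D i)) (range (D j)))

/-- A `(g; k₁, k₂, k₃)`-trisection `X = V₁ ∪ V₂ ∪ V₃` with central surface `Σ = V₁ ∩ V₂ ∩ V₃`
(parametrized by the surface `S`), together with a diagram `(Σ; α, β, γ)` of it: oriented defining
curves for the handlebodies `W_α = V₁ ∩ V₂`, `W_β = V₁ ∩ V₃` and `W_γ = V₂ ∩ V₃`. -/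
structure TrisectionDiagram (g k₁ k₂ k₃ : ℕ) (S X : Type) [TopologicalSpace S]
    [TopologicalSpace X] [ChartedSpace (EuclideanSpace ℝ (Fin 2)) S] where
  V₁ : Set X
  V₂ : Set X
  V₃ : Set X
  cover : V₁ ∪ V₂ ∪ V₃ = univ
  emb : C(S, X)
  isEmbedding : Topology.IsEmbedding emb
  range_emb : range emb = V₁ ∩ V₂ ∩ V₃
  sector₁ : IsModelled (handlebody4 k₁) V₁ (V₁ ∩ V₂ ∪ V₁ ∩ V₃)
  sector₂ : IsModelled (handlebody4 k₂) V₂ (V₁ ∩ V₂ ∪ V₂ ∩ V₃)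
  sector₃ : IsModelled (handlebody4 k₃) V₃ (V₁ ∩ V₃ ∪ V₂ ∩ V₃)
  handlebody_α : IsModelled (handlebody3 g) (V₁ ∩ V₂) (range emb)
  handlebody_β : IsModelled (handlebody3 g) (V₁ ∩ V₃) (range emb)
  handlebody_γ : IsModelled (handlebody3 g) (V₂ ∩ V₃) (range emb)
  α : Fin g → SmoothLoop S
  β : Fin g → SmoothLoop S
  γ : Fin g → SmoothLoop S
  defining_α : IsDefiningCurves emb (V₁ ∩ V₂) α
  defining_β : IsDefiningCurves emb (V₁ ∩ V₃) β
  defining_γ : IsDefiningCurves emb (V₂ ∩ V₃) γ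

/-! ## Curves, intersection matrices and Lagrangians -/

section Curves

variable {S : Type} [TopologicalSpace S] [ChartedSpace (EuclideanSpace ℝ (Fin 2)) S] {g : ℕ}

/-- The matrix `_aQ_b` of intersection numbers `⟨[a_i], [b_j]⟩`. -/
def intersectionMatrix (a b : Fin g → SmoothLoop S) : Matrix (Fin g) (Fin g) ℤ :=
  Matrix.of fun i j => intersectionForm S (a i).homologyClass (b j).homologyClass

/-- The subgroup of `H_1(S; ℤ)` generated by the curves. -/
def curveSpan (c : Fin g → SmoothLoop S) : Submodule ℤ (singHomology 1 S) :=
  Submodule.span ℤ (range fun i => (c i).homologyClass)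

/-- The class `∑ vᵢ [cᵢ]` with coordinate vector `v`. -/
def curveComb (c : Fin g → SmoothLoop S) (v : Fin g → ℤ) : singHomology 1 S :=
  ∑ i, v i • (c i).homologyClass

/-- Disjoint simple closed curves span an isotropic subgroup. -/
theorem curveSpan_isotropic (c : Fin g → SmoothLoop S)
    (hc : ∀ i j, i ≠ j → Disjoint (range (c i).toFun) (range (c j).toFun)) :
    ∀ x ∈ curveSpan c, ∀ y ∈ curveSpan c, intersectionForm S x y = 0 := by
  have key : ∀ i j, intersectionForm S (c i).homologyClass (c j).homologyClass = 0 := by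
    intro i j
    unfold intersectionForm
    split_ifs with h
    · by_cases hij : i = j
      · subst hij
        exact h.choose_spec.1 _
      · have hm : (c i).meets (c j) = ∅ := by
          ext p
          simp only [SmoothLoop.meets, mem_ofPred_eq, mem_empty_iff_false, iff_false]
          rintro ⟨-, -, hp⟩
          exact (Set.disjoint_left.1 (hc i j hij)) (mem_range_self p.1) (hp ▸ mem_range_self p.2)
        rw [h.choose_spec.2 _ _ (by intro p hp; rw [hm] at hp; exact hp.elim)]
        simp [SmoothLoop.signedCount, hm]
    · rfl
  intro x hx y hy
  refine Submodule.span_induction₂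
    (p := fun x y _ _ => intersectionForm S x y = 0) ?_ ?_ ?_ ?_ ?_ ?_ ?_ hx hy
  · rintro _ _ ⟨i, rfl⟩ ⟨j, rfl⟩
    exact key i j
  · intros; simp
  · intros; simp
  · intro x y z _ _ _ h1 h2; simp [h1, h2]
  · intro x y z _ _ _ h1 h2; simp [h1, h2]
  · intro r x y _ _ h1; simp [h1]
  · intro r x y _ _ h1; simp [h1]

end Curves

/-! ## The form `Φ` -/

section Wall

variable {R H : Type} [CommRing R] [AddCommGroup H] [Module R H] (F : LinearMap.BilinForm R H)
  {La Lb Lc : Submodule R H}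

theorem exists_component (x : ↥(Lc ⊓ (La ⊔ Lb))) : ∃ x' ∈ La, (x : H) - x' ∈ Lb := by
  obtain ⟨a, ha, b, hb, h⟩ := Submodule.mem_sup.1 x.2.2
  exact ⟨a, ha, by rw [← h, add_sub_cancel_left]; exact hb⟩

theorem pairing_component_eq (hα : ∀ x ∈ La, ∀ y ∈ La, F x y = 0)
    (hβ : ∀ x ∈ Lb, ∀ y ∈ Lb, F x y = 0) {x p q y : H} (hy : y ∈ La ⊔ Lb)
    (hp : p ∈ La) (hp' : x - p ∈ Lb) (hq : q ∈ La) (hq' : x - q ∈ Lb) : F p y = F q y := by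
  obtain ⟨a, ha, b, hb, rfl⟩ := Submodule.mem_sup.1 hy
  have h1 : F (p - q) a = 0 := hα _ (sub_mem hp hq) _ ha
  have h2 : F (p - q) b = 0 := by
    refine hβ _ ?_ _ hb
    have : p - q = (x - q) - (x - p) := by abel
    rw [this]; exact sub_mem hq' hp'
  have h3 : F (p - q) (a + b) = 0 := by rw [map_add, h1, h2, add_zero]
  rw [map_sub, LinearMap.sub_apply] at h3
  exact sub_eq_zero.1 h3

/-- The form `Φ(x, y) = F(x', y)` on `Lc ∩ (La + Lb)`, where `x'` is any element of `La` with
`x - x' ∈ Lb`. -/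
def wallForm (hα : ∀ x ∈ La, ∀ y ∈ La, F x y = 0) (hβ : ∀ x ∈ Lb, ∀ y ∈ Lb, F x y = 0) :
    LinearMap.BilinForm R ↥(Lc ⊓ (La ⊔ Lb)) :=
  LinearMap.mk₂ R (fun x y => F (exists_component x).choose (y : H))
    (fun x₁ x₂ y => by
      have h₁ := (exists_component x₁).choose_spec
      have h₂ := (exists_component x₂).choose_spec
      have h := (exists_component (x₁ + x₂)).choose_spec
      rw [← LinearMap.add_apply, ← map_add]
      refine pairing_component_eq F hα hβ y.2.2 h.1 h.2 (add_mem h₁.1 h₂.1) ?_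
      rw [Submodule.coe_add, add_sub_add_comm]
      exact add_mem h₁.2 h₂.2)
    (fun r x y => by
      have h₁ := (exists_component x).choose_spec
      have h := (exists_component (r • x)).choose_spec
      rw [← LinearMap.smul_apply, ← map_smul]
      refine pairing_component_eq F hα hβ y.2.2 h.1 h.2 (Submodule.smul_mem _ r h₁.1) ?_
      rw [Submodule.coe_smul, ← smul_sub]
      exact Submodule.smul_mem _ r h₁.2)
    (fun x y₁ y₂ => by simp)
    (fun r x y => by simp)

theorem wallForm_eq (hα : ∀ x ∈ La, ∀ y ∈ La, F x y = 0)
    (hβ : ∀ x ∈ Lb, ∀ y ∈ Lb, F x y = 0) (x y : ↥(Lc ⊓ (La ⊔ Lb))) {x' : H} (h : x' ∈ La)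
    (h' : (x : H) - x' ∈ Lb) : wallForm F hα hβ x y = F x' y :=
  pairing_component_eq F hα hβ y.2.2 (exists_component x).choose_spec.1
    (exists_component x).choose_spec.2 h h'

end Wall

namespace TrisectionDiagram

variable {g k₁ k₂ k₃ : ℕ} {S X : Type} [TopologicalSpace S] [TopologicalSpace X]
  [ChartedSpace (EuclideanSpace ℝ (Fin 2)) S] (T : TrisectionDiagram g k₁ k₂ k₃ S X)

/-- The subgroup `L_γ ∩ (L_α + L_β)` of `H_1(Σ; ℤ)`. -/
def N : Submodule ℤ (singHomology 1 S) :=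
  curveSpan T.γ ⊓ (curveSpan T.α ⊔ curveSpan T.β)

/-- The form `Φ` on `L_γ ∩ (L_α + L_β)`: `Φ(x, y) = ⟨x', y⟩`, where `x' ∈ L_α`, `x - x' ∈ L_β`. -/
def Φ : @LinearMap.BilinForm ℤ _ ↥T.N _ T.N.module :=
  wallForm (intersectionForm S) (curveSpan_isotropic T.α T.defining_α.2.1)
    (curveSpan_isotropic T.β T.defining_β.2.1)

/-- The inclusion of the central surface into a subset of `X` that contains it. -/
def surfaceTo (W : Set X) (hW : T.V₁ ∩ T.V₂ ∩ T.V₃ ⊆ W) : C(S, W) where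
  toFun s := ⟨T.emb s, hW (T.range_emb ▸ mem_range_self s)⟩
  continuous_toFun := T.emb.continuous.subtype_mk _

/-- The inclusion of a subset of `X`. -/
def inclusion (W : Set X) : C(W, X) := ⟨Subtype.val, continuous_subtype_val⟩

/-- The element `x` of `L_γ ∩ (L_α + L_β)` represents the class `z ∈ H_2(X; ℤ)`: a 1-cycle `c` in
`Σ` of class `x` bounds a chain `u_γ` in `W_γ`, it is a sum `c = a + b` of 1-cycles that
bound chains `u_α` in `W_α` and `u_β` in `W_β` (so that `u_α + u_β` is a "Seifert surface" of `c` in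
`∂V₁ = W_α ∪ W_β`), and `z` is the class of the closed surface `u_γ - (u_α + u_β)`. -/
def Represents (x : ↥T.N) (z : singHomology 2 X) : Prop :=
  ∃ (a b c : (singChains S).X 1) (uα : (singChains ↥(T.V₁ ∩ T.V₂)).X 2)
    (uβ : (singChains ↥(T.V₁ ∩ T.V₃)).X 2) (uγ : (singChains ↥(T.V₂ ∩ T.V₃)).X 2),
    IsCycleOfClass c (x : singHomology 1 S) ∧ c = a + b ∧
    chainBoundary _ 1 uα = chainPush (T.surfaceTo (T.V₁ ∩ T.V₂) fun _ h => h.1) 1 a ∧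
    chainBoundary _ 1 uβ = chainPush (T.surfaceTo (T.V₁ ∩ T.V₃) fun _ h => ⟨h.1.1, h.2⟩) 1 b ∧
    chainBoundary _ 1 uγ = chainPush (T.surfaceTo (T.V₂ ∩ T.V₃) fun _ h => ⟨h.1.2, h.2⟩) 1 c ∧
    IsCycleOfClass (chainPush (inclusion (T.V₂ ∩ T.V₃)) 2 uγ
      - (chainPush (inclusion (T.V₁ ∩ T.V₂)) 2 uα
        + chainPush (inclusion (T.V₁ ∩ T.V₃)) 2 uβ)) z

end TrisectionDiagram

/-- `H_2(X; ℤ)` modulo its torsion subgroup. -/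
abbrev H2ModTorsion (X : Type) [TopologicalSpace X] : Type :=
  singHomology 2 X ⧸ Submodule.torsion ℤ (singHomology 2 X)

/-- The class modulo torsion of an element of `H_2(X; ℤ)`. -/
def modTorsion {X : Type} [TopologicalSpace X] (z : singHomology 2 X) : H2ModTorsion X :=
  Submodule.Quotient.mk z

/-- The bilinear form `B` on `H_2(X; ℤ)/torsion` is the one that `Φ` induces. -/
def TrisectionDiagram.IsInducedForm {g k₁ k₂ k₃ : ℕ} {S X : Type} [TopologicalSpace S]
    [TopologicalSpace X] [ChartedSpace (EuclideanSpace ℝ (Fin 2)) S]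
    (T : TrisectionDiagram g k₁ k₂ k₃ S X) (B : LinearMap.BilinForm ℤ (H2ModTorsion X)) : Prop :=
  ∀ (x y : ↥T.N) (z w : singHomology 2 X), T.Represents x z → T.Represents y w →
    B (modTorsion z) (modTorsion w) = T.Φ x y

/-- The `g × g` matrix `I_g^m`: the identity matrix in the upper left `m × m` block and zero
elsewhere. -/
def blockIdentity (g m : ℕ) : Matrix (Fin g) (Fin g) ℤ :=
  Matrix.diagonal fun i => if (i : ℕ) < m then 1 else 0

end

/-! The identity is linear algebra on two isotropic subgroups whose generators pair diagonally.
Write x = ∑ pᵢ αᵢ + (element of L_β) and y = (element of L_α) + ∑ qᵢ βᵢ in homology, and let dᵢ ∈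
{0, 1} be the diagonal entries of `I_g^{g-k₁}`. Isotropy gives ⟨x, βᵢ⟩ = pᵢ dᵢ and ⟨αᵢ, y⟩ = dᵢ qᵢ,
while Φ(x, y) = ∑ pᵢ ⟨αᵢ, y⟩ = ∑ pᵢ dᵢ qᵢ. The coefficients pᵢ with dᵢ = 0 are invisible to the
numbers ⟨x, βᵢ⟩, but they do not contribute to Φ either. Since dᵢ is idempotent, Φ(x, y) = ∑ ⟨x, βᵢ⟩
dᵢ ⟨αᵢ, y⟩; this is `wallForm_eq_sum`. For x and y given by columns of A, the right-hand side is an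
entry of the matrix product. An induced form takes these same values on the basis vectors. -/

/-- If `La` and `Lb` are isotropic, spanned by `a` and `b` with `F (a i) (b j)` the diagonal matrix
with entries `d i ∈ {0, 1}`, then `F(x', y) = ∑ i, F x (b i) * d i * F (a i) y`. -/
theorem wallForm_eq_sum {R H ι : Type} [CommRing R] [AddCommGroup H] [Module R H] [Fintype ι]
    [DecidableEq ι] (F : LinearMap.BilinForm R H) {La Lb Lc : Submodule R H} {a b : ι → H}
    (ha : La = Submodule.span R (range a)) (hb : Lb = Submodule.span R (range b))
    (hα : ∀ x ∈ La, ∀ y ∈ La, F x y = 0) (hβ : ∀ x ∈ Lb, ∀ y ∈ Lb, F x y = 0)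
    {d : ι → R} (hd : ∀ i, d i * d i = d i) (hF : ∀ i j, F (a i) (b j) = Matrix.diagonal d i j)
    (x y : ↥(Lc ⊓ (La ⊔ Lb))) :
    wallForm F hα hβ x y = ∑ i, F (x : H) (b i) * d i * F (a i) (y : H) := by
  subst ha hb
  have hb_mem : ∀ i, b i ∈ Submodule.span R (range b) := fun i =>
    Submodule.subset_span (mem_range_self i)
  have ha_mem : ∀ i, a i ∈ Submodule.span R (range a) := fun i =>
    Submodule.subset_span (mem_range_self i)
  obtain ⟨x', hx', hxx'⟩ := exists_component x
  obtain ⟨y', hy', hyy'⟩ := exists_component y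
  rw [wallForm_eq F hα hβ x y hx' hxx']
  obtain ⟨p, hp⟩ := (Submodule.mem_span_range_iff_exists_fun R).1 hx'
  -- Only the L_β part of y needs coordinates: its L_α part pairs to zero with every `a i`.
  obtain ⟨q, hq⟩ := (Submodule.mem_span_range_iff_exists_fun R).1 hyy'
  -- Pairing with `b i` kills the L_β part of x, so x may be replaced by `x'`.
  have hx : ∀ i, F (x : H) (b i) = p i * d i := fun i => by
    have h : F ((x : H) - x') (b i) = 0 := hβ _ hxx' _ (hb_mem i)
    rw [map_sub, LinearMap.sub_apply, sub_eq_zero] at h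
    rw [h, ← hp]
    simp [hF, Matrix.diagonal_apply]
  have hy : ∀ i, F (a i) (y : H) = d i * q i := fun i => by
    have h : F (a i) (y : H) = F (a i) y' + F (a i) ((y : H) - y') := by
      rw [← map_add, add_sub_cancel]
    rw [h, hα _ (ha_mem i) _ hy', zero_add, ← hq]
    simp [hF, Matrix.diagonal_apply, mul_comm]
  have hsum : F x' (y : H) = ∑ i, p i * F (a i) (y : H) := by
    rw [← hp]
    simp
  rw [hsum]
  refine Finset.sum_congr rfl fun i _ => ?_
  rw [hx, hy]
  -- What remains is p d q = p d³ q, and d³ - d = (1 + d)(d² - d).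
  linear_combination (-(p i * q i * (1 + d i))) * hd i

theorem mainTheorem7 {g k₁ k₂ k₃ : ℕ} {S X : Type}
    [TopologicalSpace S] [T2Space S] [CompactSpace S] [ConnectedSpace S]
    [ChartedSpace (EuclideanSpace ℝ (Fin 2)) S] [IsManifold (𝓡 2) ∞ S]
    (hS : IsOrientedAtlas 2 S)
    [TopologicalSpace X] [T2Space X] [CompactSpace X] [ConnectedSpace X]
    [ChartedSpace (EuclideanSpace ℝ (Fin 4)) X] [IsManifold (𝓡 4) ∞ X]
    (hX : IsOrientedAtlas 4 X)
    (T : TrisectionDiagram g k₁ k₂ k₃ S X)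
    (hQ : intersectionMatrix T.α T.β = blockIdentity g (g - k₁))
    {n : ℕ} (A : Matrix (Fin g) (Fin n) ℤ) (hA : ∀ j, curveComb T.γ (A.col j) ∈ T.N)
    (b : Module.Basis (Fin n) ℤ (H2ModTorsion X))
    (hb : ∀ j, ∃ z : singHomology 2 X, T.Represents ⟨curveComb T.γ (A.col j), hA j⟩ z ∧
      modTorsion z = b j) :
    (Matrix.of fun i j =>
        T.Φ ⟨curveComb T.γ (A.col i), hA i⟩ ⟨curveComb T.γ (A.col j), hA j⟩) =
      A.transpose * intersectionMatrix T.γ T.β * blockIdentity g (g - k₁) *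
        intersectionMatrix T.α T.γ * A ∧
    ∀ B : LinearMap.BilinForm ℤ (H2ModTorsion X), T.IsInducedForm B →
      LinearMap.BilinForm.toMatrix b B =
        A.transpose * intersectionMatrix T.γ T.β * blockIdentity g (g - k₁) *
          intersectionMatrix T.α T.γ * A := by
  have hΦ : ∀ i j, T.Φ ⟨curveComb T.γ (A.col i), hA i⟩ ⟨curveComb T.γ (A.col j), hA j⟩ =
      (A.transpose * intersectionMatrix T.γ T.β * blockIdentity g (g - k₁) *
        intersectionMatrix T.α T.γ * A) i j := by
    intro i j
    refine (wallForm_eq_sum (intersectionForm S) rfl rfl _ _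
      (d := fun i : Fin g => if (i : ℕ) < g - k₁ then 1 else 0) (fun i => by simp)
      -- Entrywise, `hQ` is the diagonal hypothesis, since `blockIdentity` unfolds to
      -- `Matrix.diagonal` of this 0/1 function.
      (fun i j => congrFun (congrFun hQ i) j) _ _).trans ?_
    -- This bracketing makes the outer summation index l the one of the diagonal matrix; the two
    -- outer factors of each summand are then ⟨xᵢ, β_l⟩ and ⟨α_l, xⱼ⟩, expanded in the
    -- γ-coordinates.
    rw [Matrix.mul_assoc _ (intersectionMatrix T.α T.γ) A, Matrix.mul_apply]
    refine Finset.sum_congr rfl fun l _ => ?_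
    rw [blockIdentity, Matrix.mul_diagonal]
    simp [Matrix.mul_apply, intersectionMatrix, curveComb, mul_comm]
  refine ⟨Matrix.ext hΦ, fun B hB => Matrix.ext fun i j => ?_⟩
  -- The basis vectors are replaced by the homology classes that the columns represent, where the
  -- value of `B` is prescribed by `Φ`.
  obtain ⟨z, hz, hzb⟩ := hb i
  obtain ⟨w, hw, hwb⟩ := hb j
  rw [LinearMap.BilinForm.toMatrix_apply, ← hzb, ← hwb, hB _ _ z w hz hw, hΦ]
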